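/- Rings are commutative with $1$. A profinite ring is a topological ring whose underlying space is compact, Hausdorff and totally disconnected; call it separable if its topology has a countable base. Say that a profinite ring $R$ is finitely axiomatizable within a class $\mathcal C$ of profinite rings if there is a first-order sentence $\varphi$ in the language of rings such that $R\models\varphi$ and every $S\in\mathcal C$ with $S\models\varphi$ is topologically isomorphic to $R$ (isomorphic by a ring isomorphism that is a homeomorphism). **Proposition** (going back to Scanlon, 2016). Let $\pi$ be an infinite set of primes and let $R=\prod_{p\in\pi}\mathbb Z_p$, with the product topology, where $\mathbb Z_p$ is the ring of $p$-adic integers. Then $R$ is not finitely axiomatizable within the class of profinite rings, and also not within the class of separable profinite rings. -/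

import Mathlib

open FirstOrder

/-- A profinite (commutative, unital) ring: a commutative topological ring whose underlying space
is compact, Hausdorff and totally disconnected. -/
structure ProfiniteCommRing where
  carrier : Type
  [commRing : CommRing carrier]
  [topologicalSpace : TopologicalSpace carrier]
  [isTopologicalRing : IsTopologicalRing carrier]
  [compactSpace : CompactSpace carrier]
  [t2Space : T2Space carrier]
  [totallyDisconnectedSpace : TotallyDisconnectedSpace carrier]

namespace ProfiniteCommRing

attribute [instance] commRing topologicalSpace isTopologicalRing compactSpace t2Space
  totallyDisconnectedSpace

/-- The first-order sentence `φ` of the language `(+, *, -, 0, 1)` of rings holds in (the abstract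
ring underlying) `R`. The topology is not part of the language. -/
def Satisfies (R : ProfiniteCommRing) (φ : Language.ring.Sentence) : Prop :=
  letI := Ring.compatibleRingOfRing R.carrier
  R.carrier ⊨ φ

/-- Topological isomorphism: a ring isomorphism that is a homeomorphism. -/
def TopIso (R S : ProfiniteCommRing) : Prop :=
  ∃ e : R.carrier ≃+* S.carrier, Continuous e ∧ Continuous e.symm

/-- A profinite ring is separable, in the usual sense for profinite structures, if its topology has
a countable base. -/
def IsCountablyBased (R : ProfiniteCommRing) : Prop :=
  SecondCountableTopology R.carrier

/-- `R` is finitely axiomatizable within a class `C` of profinite rings: some first-order sentence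
holds in `R` and, among the members of `C`, only in those topologically isomorphic to `R`. -/
def IsFAWithin (C : Set ProfiniteCommRing) (R : ProfiniteCommRing) : Prop :=
  ∃ φ : Language.ring.Sentence, R.Satisfies φ ∧ ∀ S ∈ C, S.Satisfies φ → TopIso S R

/-- Primality of a bundled prime as an instance, needed to form `ℤ_[p]`. -/
instance factPrime (p : Nat.Primes) : Fact (p : ℕ).Prime := ⟨p.2⟩

/-- The profinite ring `∏_{p ∈ π} ℤ_p` with the product topology, for a set `π` of primes. -/
noncomputable def prodPadicInt (π : Set Nat.Primes) : ProfiniteCommRing where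
  carrier := ∀ p : π, ℤ_[((p : Nat.Primes) : ℕ)]

end ProfiniteCommRing

namespace ProfiniteCommRing

/-! By a Feferman–Vaught argument, the truth of a sentence in a product of rings depends only on how
many factors have each of finitely many colours. With infinitely many factors `ℤ_p`, some colour
occurs infinitely often, and deleting one factor `ℤ_q` of that colour preserves the sentence. Yet
`q` is a unit in the smaller product and not in the original, so the two are not even abstractly
isomorphic. -/

/-- Terms of the language of rings are evaluated coordinatewise in a product of rings. -/
theorem realize_term_pi {α I : Type} (M : I → Type) [∀ i, CommRing (M i)]
    (t : Language.ring.Term α) (v : α → ∀ i, M i) (i : I) :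
    (letI := Ring.compatibleRingOfRing (∀ i, M i); t.realize v) i =
      letI := Ring.compatibleRingOfRing (M i); t.realize (fun k => v k i) := by
  let := Ring.compatibleRingOfRing (∀ i, M i)
  let := Ring.compatibleRingOfRing (M i)
  induction t with
  | var => rfl
  | func f ts ih =>
    cases f <;> simp_all [Language.Term.realize, Ring.CompatibleRing.funMap_add,
      Ring.CompatibleRing.funMap_mul, Ring.CompatibleRing.funMap_neg,
      Ring.CompatibleRing.funMap_zero, Ring.CompatibleRing.funMap_one]

/-- A finite-colour form of the Feferman–Vaught theorem: each formula in the language of rings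
admits a finite colouring of tuples in rings such that the truth of the formula in a product only
depends on the colours of the coordinates. -/
theorem exists_finite_coloring {α : Type} {n : ℕ} (φ : Language.ring.BoundedFormula α n) :
    ∃ (C : Type) (_ : Finite C) (col : ∀ (M : Type) [CommRing M], (α → M) → (Fin n → M) → C),
      ∀ (I J : Type) (e : I ≃ J) (M : I → Type) (N : J → Type) [∀ i, CommRing (M i)]
        [∀ j, CommRing (N j)] (v : α → ∀ i, M i) (w : α → ∀ j, N j)
        (a : Fin n → ∀ i, M i) (b : Fin n → ∀ j, N j),
        (∀ i j, e i = j → col (M i) (fun k => v k i) (fun k => a k i) =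
          col (N j) (fun k => w k j) (fun k => b k j)) →
        ((letI := Ring.compatibleRingOfRing (∀ i, M i); φ.Realize v a) ↔
          (letI := Ring.compatibleRingOfRing (∀ j, N j); φ.Realize w b)) := by
  induction φ with
  | falsum => exact ⟨Unit, inferInstance, fun _ _ _ _ => (), fun _ _ _ _ _ _ _ _ _ _ _ _ => Iff.rfl⟩
  | equal t₁ t₂ =>
    refine ⟨Prop, inferInstance, fun M _ v a => letI := Ring.compatibleRingOfRing M
      t₁.realize (Sum.elim v a) = t₂.realize (Sum.elim v a), ?_⟩
    intro I J e M N _ _ v w a b h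
    have key : ∀ {m : ℕ} (K : Type) (P : K → Type) [∀ k, CommRing (P k)] (v : α → ∀ k, P k)
        (a : Fin m → ∀ k, P k) (t : Language.ring.Term (α ⊕ Fin m)) (k : K),
        (letI := Ring.compatibleRingOfRing (∀ k, P k); t.realize (Sum.elim v a)) k =
        letI := Ring.compatibleRingOfRing (P k)
        t.realize (Sum.elim (fun l => v l k) (fun l => a l k)) := by
      intro m K P _ v a t k
      rw [realize_term_pi]
      congr 1
      ext x
      cases x <;> rfl
    change (_ = _) ↔ (_ = _)
    rw [funext_iff, funext_iff, ← e.forall_congr_right]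
    refine forall_congr' fun i => ?_
    rw [key, key, key, key]
    exact iff_of_eq (h i _ rfl)
  | rel R => exact R.elim
  | imp φ ψ ihφ ihψ =>
    obtain ⟨C, hC, c, hc⟩ := ihφ
    obtain ⟨D, hD, d, hd⟩ := ihψ
    refine ⟨C × D, inferInstance, fun M _ v a => (c M v a, d M v a), ?_⟩
    intro I J e M N _ _ v w a b h
    exact imp_congr (hc I J e M N v w a b fun i j hij => congrArg Prod.fst (h i j hij))
      (hd I J e M N v w a b fun i j hij => congrArg Prod.snd (h i j hij))
  | all φ ih =>
    obtain ⟨C, hC, c, hc⟩ := ih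
    -- The new colour is the set of colours for `φ` attained when the tuple is extended by one
    -- element; a finite `C` has finitely many subsets.
    refine ⟨Set C, inferInstance, fun M _ v a => Set.range fun x => c M v (Fin.snoc a x), ?_⟩
    have snoc_apply : ∀ {m : ℕ} (K : Type) (P : K → Type) (a : Fin m → ∀ k, P k)
        (x : ∀ k, P k) (k : K), (fun l => (Fin.snoc a x : Fin (m + 1) → ∀ k, P k) l k) =
          (Fin.snoc (fun l => a l k) (x k) : Fin (m + 1) → P k) := by
      intro m K P a x k
      ext l
      refine Fin.lastCases ?_ (fun l => ?_) l <;> simp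
    have forth : ∀ (I J : Type) (e : I ≃ J) (M : I → Type) (N : J → Type) [∀ i, CommRing (M i)]
        [∀ j, CommRing (N j)] (v : α → ∀ i, M i) (w : α → ∀ j, N j)
        (a : Fin _ → ∀ i, M i) (b : Fin _ → ∀ j, N j),
        (∀ i j, e i = j → (Set.range fun x => c (M i) (fun k => v k i)
            (Fin.snoc (fun k => a k i) x)) =
          Set.range fun x => c (N j) (fun k => w k j) (Fin.snoc (fun k => b k j) x)) →
        (letI := Ring.compatibleRingOfRing (∀ i, M i); φ.all.Realize v a) →
          (letI := Ring.compatibleRingOfRing (∀ j, N j); φ.all.Realize w b) := by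
      intro I J e M N _ _ v w a b h hM y
      -- Equal colour sets let each coordinate of `y` be matched in colour; the choices combine
      -- freely because the product is full.
      have hx : ∀ i, ∃ x, c (M i) (fun k => v k i) (Fin.snoc (fun k => a k i) x) =
          c (N (e i)) (fun k => w k (e i)) (Fin.snoc (fun k => b k (e i)) (y (e i))) := by
        intro i
        have := h i _ rfl
        exact this.symm.subset ⟨y (e i), rfl⟩
      choose x hx using hx
      refine (hc I J e M N v w (Fin.snoc a x) (Fin.snoc b y) ?_).1 (hM x)
      rintro i _ rfl
      rw [snoc_apply, snoc_apply]
      exact hx i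
    intro I J e M N _ _ v w a b h
    exact ⟨forth I J e M N v w a b h, forth J I e.symm N M w v b a fun j i hij =>
      (h i j (by rw [← hij, e.apply_symm_apply])).symm⟩

/-- For every finite colouring of a countably infinite set, some point can be deleted from the set
up to a colour-preserving bijection. -/
theorem exists_equiv_diff_singleton {X C : Type} [Countable X] [Finite C] {s : Set X}
    (hs : s.Infinite) (f : X → C) :
    ∃ q ∈ s, ∃ e : s ≃ (s \ {q} : Set X), ∀ x, f (e x) = f x := by
  classical
  have := hs.to_subtype
  obtain ⟨c, hc⟩ := Finite.exists_infinite_fiber (fun x : s => f x)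
  have hinf : (s ∩ f ⁻¹' {c}).Infinite := by
    rw [← Subtype.image_preimage_coe]
    exact (Set.infinite_coe_iff.1 hc).image Subtype.val_injective.injOn
  obtain ⟨q, hqs, hqc⟩ := hinf.nonempty
  -- The fibre over `c` is countably infinite before and after deletion; the other fibres do not
  -- contain `q`.
  have key : ∀ d, Nonempty ({x : s // f x = d} ≃ {x : (s \ {q} : Set X) // f x = d}) := by
    intro d
    by_cases hd : d = c
    · subst hd
      have h1 : Infinite {x : s // f x = d} := hc
      have h2 : Infinite {x : (s \ {q} : Set X) // f x = d} := by
        have := (hinf.sdiff (Set.finite_singleton q)).to_subtype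
        exact Infinite.of_injective
          (fun x : ((s ∩ f ⁻¹' {d}) \ {q} : Set X) =>
            (⟨⟨x, x.2.1.1, x.2.2⟩, x.2.1.2⟩ : {x : (s \ {q} : Set X) // f x = d}))
          fun x y h => Subtype.ext (congrArg (fun z => (z.1 : X)) h)
      exact nonempty_equiv_of_countable
    · refine ⟨⟨fun x => ⟨⟨x.1, x.1.2, ?_⟩, x.2⟩, fun x => ⟨⟨x.1, x.1.2.1⟩, x.2⟩,
        fun _ => rfl, fun _ => rfl⟩⟩
      intro hx
      exact hd (x.2.symm.trans ((congrArg f hx).trans hqc))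
  exact ⟨q, hqs, Equiv.ofFiberEquiv fun d => (key d).some,
    fun x => Equiv.ofFiberEquiv_map (f := fun x : s => f x)
      (g := fun x : (s \ {q} : Set X) => f x) _ x⟩

/-- A sentence true in a product of infinitely many rings `ℤ_p` stays true after deleting a
suitable factor. -/
theorem exists_satisfies_diff_singleton {π : Set Nat.Primes} (hπ : π.Infinite)
    {φ : Language.ring.Sentence} (hφ : (prodPadicInt π).Satisfies φ) :
    ∃ q ∈ π, (prodPadicInt (π \ {q})).Satisfies φ := by
  obtain ⟨C, _, col, hcol⟩ := exists_finite_coloring φ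
  have : Countable Nat.Primes := Subtype.countable
  -- A sentence has no free variables, so the colour depends on the ring `ℤ_p` alone.
  obtain ⟨q, hq, e, he⟩ := exists_equiv_diff_singleton hπ
    (fun p : Nat.Primes => col ℤ_[(p : ℕ)] (fun k => k.elim) (fun k => k.elim0))
  refine ⟨q, hq, ?_⟩
  refine (hcol π (π \ {q} : Set Nat.Primes) e (fun p => ℤ_[((p : Nat.Primes) : ℕ)])
    (fun p => ℤ_[((p : Nat.Primes) : ℕ)]) (@default _ Unique.instInhabited)
    (@default _ Unique.instInhabited) (@default _ Unique.instInhabited)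
    (@default _ Unique.instInhabited) ?_).1 hφ
  rintro i _ rfl
  convert (he i).symm

/-- Deleting a factor `ℤ_q` changes the isomorphism type, since `q` becomes invertible. -/
theorem not_topIso_diff_singleton {π : Set Nat.Primes} {q : Nat.Primes} (hq : q ∈ π) :
    ¬ TopIso (prodPadicInt (π \ {q})) (prodPadicInt π) := by
  rintro ⟨e, -, -⟩
  have hS : IsUnit ((q : ℕ) : (prodPadicInt (π \ {q})).carrier) := by
    refine Pi.isUnit_iff.2 fun p => ?_
    change IsUnit ((q : ℕ) : ℤ_[((p : Nat.Primes) : ℕ)])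
    rw [PadicInt.isUnit_iff, PadicInt.norm_natCast_eq_one_iff]
    exact (Nat.coprime_primes p.1.2 q.2).2 fun h => p.2.2 (Subtype.ext h)
  have hR : IsUnit ((q : ℕ) : (prodPadicInt π).carrier) := by
    simpa using hS.map e
  have hunit : IsUnit ((q : ℕ) : ℤ_[(q : ℕ)]) := Pi.isUnit_iff.1 hR ⟨q, hq⟩
  exact PadicInt.prime_p.not_isUnit hunit

theorem isCountablyBased_prodPadicInt (π : Set Nat.Primes) :
    (prodPadicInt π).IsCountablyBased := by
  have : Countable Nat.Primes := Subtype.countable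
  have (p : π) : SecondCountableTopology ℤ_[((p : Nat.Primes) : ℕ)] :=
    UniformSpace.secondCountable_of_separable _
  exact inferInstanceAs
    (SecondCountableTopology (∀ p : π, ℤ_[((p : Nat.Primes) : ℕ)]))

theorem not_isFAWithin_prodPadicInt {π : Set Nat.Primes} (hπ : π.Infinite)
    {C : Set ProfiniteCommRing} (hC : ∀ q ∈ π, prodPadicInt (π \ {q}) ∈ C) :
    ¬ IsFAWithin C (prodPadicInt π) := by
  rintro ⟨φ, hφ, h⟩
  obtain ⟨q, hq, hS⟩ := exists_satisfies_diff_singleton hπ hφ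
  exact not_topIso_diff_singleton hq (h _ (hC q hq) hS)

end ProfiniteCommRing

theorem mainTheorem10 (π : Set Nat.Primes) (hπ : π.Infinite) :
    ¬ ProfiniteCommRing.IsFAWithin Set.univ (ProfiniteCommRing.prodPadicInt π) ∧
    ¬ ProfiniteCommRing.IsFAWithin {S | S.IsCountablyBased}
        (ProfiniteCommRing.prodPadicInt π) :=
  ⟨ProfiniteCommRing.not_isFAWithin_prodPadicInt hπ fun _ _ => Set.mem_univ _,
    ProfiniteCommRing.not_isFAWithin_prodPadicInt hπ fun _ _ =>
      ProfiniteCommRing.isCountablyBased_prodPadicInt _⟩
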